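/- Let $G$ be a countable (finite or infinite) locally finite group, i.e. every finitely generated subgroup of $G$ is finite, and let $f:\mathbb N\to\mathbb R$ be an increasing (i.e. nondecreasing) unbounded function. Then there exist a finite alphabet $\mathcal A$ and a nonempty minimal subshift $X\subseteq\mathcal A^{\mathbb Z}$ such that $$\mathrm{Aut}(X,\sigma)/\langle\sigma\rangle\cong G\qquad\text{and}\qquad \lim_{n\to\infty}\frac{c_n(X)}{n f(n)}=0 .$$ Here a subshift is a closed subset $X$ of $\mathcal A^{\mathbb Z}$ (product of discrete topologies) with $\sigma(X)=X$, where $(\sigma x)(n)=x(n+1)$; $X$ is minimal if every finite word that appears in some point of $X$ appears in every point of $X$; $\mathrm{Aut}(X,\sigma)$ is the group of homeomorphisms of $X$ that commute with $\sigma$; $\langle\sigma\rangle$ is its (normal) subgroup generated by $\sigma$; and $c_n(X)$ is the number of words of length $n$ that appear in points of $X$. -/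

import Mathlib

open SymbolicDynamics.FullShift Filter Topology

/-- A group is locally finite if every finitely generated subgroup is finite. -/
def IsLocallyFiniteGroup (G : Type*) [Group G] : Prop :=
  ∀ H : Subgroup G, H.FG → Finite H

namespace TwoSidedSubshift

variable {A : Type*} [TopologicalSpace A]

/-- The word `w` is a subword of the bi-infinite sequence `x`. -/
def IsSubword {n : ℕ} (w : Fin n → A) (x : ℤ → A) : Prop :=
  ∃ i : ℤ, ∀ j : Fin n, x (i + (j : ℕ)) = w j

/-- `L_n(X)`: the set of words of length `n` occurring in points of `X`. -/
def language (X : Subshift A ℤ) (n : ℕ) : Set (Fin n → A) :=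
  {w | ∃ x ∈ X.carrier, IsSubword w x}

/-- The word complexity `c_n(X) = |L_n(X)|`. For a finite alphabet the set `L_n(X)` is finite. -/
noncomputable def complexity (X : Subshift A ℤ) (n : ℕ) : ℕ :=
  (language X n).ncard

/-- A subshift is minimal if it is nonempty and every word of its language occurs in each of its
points. -/
def IsMinimal (X : Subshift A ℤ) : Prop :=
  X.carrier.Nonempty ∧
    ∀ (n : ℕ), ∀ w ∈ language X n, ∀ x ∈ X.carrier, IsSubword w x

/-- The left shift `(σ x)(n) = x(n + 1)` as a homeomorphism of the subshift `X`. -/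
def sigma (X : Subshift A ℤ) : X.carrier ≃ₜ X.carrier where
  toFun x := ⟨shift 1 x.1, X.mapsTo 1 x.2⟩
  invFun x := ⟨shift (-1) x.1, X.mapsTo (-1) x.2⟩
  left_inv x := by
    apply Subtype.ext
    funext n
    simp
  right_inv x := by
    apply Subtype.ext
    funext n
    simp
  continuous_toFun := ((continuous_shift 1).comp continuous_subtype_val).subtype_mk _
  continuous_invFun := ((continuous_shift (-1)).comp continuous_subtype_val).subtype_mk _

/-- `Aut(X, σ)`: the group, under composition, of homeomorphisms of `X` commuting with `σ`. -/
def Aut (X : Subshift A ℤ) : Subgroup (X.carrier ≃ₜ X.carrier) where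
  carrier := {φ | ∀ x, φ (sigma X x) = sigma X (φ x)}
  one_mem' _ := rfl
  mul_mem' {φ ψ} hφ hψ x := by
    have h1 : ψ (sigma X x) = sigma X (ψ x) := hψ x
    have h2 : φ (sigma X (ψ x)) = sigma X (φ (ψ x)) := hφ (ψ x)
    rw [Homeomorph.mul_apply, Homeomorph.mul_apply, h1, h2]
  inv_mem' {φ} hφ x := by
    have h : φ (sigma X (φ.symm x)) = sigma X (φ (φ.symm x)) := hφ (φ.symm x)
    change φ.symm (sigma X x) = sigma X (φ.symm x)
    rw [φ.symm_apply_eq, h, φ.apply_symm_apply]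

/-- The shift `σ` as an element of `Aut(X, σ)`. -/
def sigmaAut (X : Subshift A ℤ) : Aut X := ⟨sigma X, fun _ => rfl⟩

/-- The subgroup `⟨σ⟩` of `Aut(X, σ)` is normal, because `σ` is central. -/
instance zpowers_sigmaAut_normal (X : Subshift A ℤ) :
    (Subgroup.zpowers (sigmaAut X)).Normal := by
  have hc : sigmaAut X ∈ Subgroup.center (Aut X) := by
    rw [Subgroup.mem_center_iff]
    intro φ
    apply Subtype.ext
    ext1 x
    exact φ.2 x
  have hle : Subgroup.zpowers (sigmaAut X) ≤ Subgroup.center (Aut X) := by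
    rwa [Subgroup.zpowers_le]
  refine ⟨fun a ha g => ?_⟩
  have h := Subgroup.mem_center_iff.1 (hle ha) g
  rw [h, mul_inv_cancel_right]
  exact ha

end TwoSidedSubshift

-- Write `G` as the union of finite subgroups `H 0 ≤ H 1 ≤ ...`, repeated so often that they grow as
-- slowly as desired. The letters of level `k` are `H k × Bool`, and a letter `s` of level `k + 1`
-- is replaced by the word `ρ₀(s) ρ₁(s) ...`, where the `ρᵢ` are `H k`-equivariant maps from `H (k +
-- 1) × Bool` to `H k × Bool` and every pair of such maps occurs consecutively. A marker of three
-- letters of type `true` makes these substitutions recognizable, so each point of the resulting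
-- subshift has a unique block structure at each level, and the occurrence of all pairs of letters
-- gives minimality.
--
-- Left multiplication by `g ∈ H k` commutes with all substitutions from level `k` on, so `G` acts
-- on the subshift (`groupSystem.actAut`). Only `g = 1` acts as a power of the shift, since left
-- multiplication is free. Conversely, an automorphism is a sliding block code. After composition
-- with a power of the shift it preserves the blocks of all large levels in a given point
-- (`exists_small_offset`, `exists_offset`) and relabels their letters (`exists_relabeling`). The
-- relabelings commute with the substitutions, hence with all equivariant maps, and this forces left
-- multiplication by an element of `G` (`EquivariantMap.exists_leftMul`). By minimality, agreement
-- at one point is enough (`aut_ext`).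
--
-- A word no longer than a block of level `k + 1` lies in two adjacent blocks, so for `len k ≤ n ≤
-- len (k + 1)` the complexity is at most `n` times a quantity depending only on the size of `H (k +
-- 1)`. Slow growth of the subgroups keeps this quantity below `√(f n)`.

universe u

/-! ### Block substitutions and recognizability -/

/-- A directive sequence of constant-length substitutions `τ k` from the finite alphabet `L (k + 1)`
to words of length `M k` over `L k`. Every letter carries a Boolean type; three consecutive letters
of type `true` mark the blocks, and the type of a letter is the type of the first and of the last
letter of its image. -/
structure BlockSystem (m : ℕ) where
  L : ℕ → Type u
  finite : ∀ k, Finite (L k)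
  M : ℕ → ℕ
  three_le_M : ∀ k, 3 ≤ M k
  τ : ∀ k, L (k + 1) → ℤ → L k
  ty : ∀ k, L k → Bool
  ty_surj : ∀ k b, ∃ s, ty k s = b
  e : L 0 ≃ Fin m
  mark : ∀ k (z : ℤ → L (k + 1)) (n : ℤ),
    (∀ i : ℤ, n ≤ i → i ≤ n + 2 → ty k (τ k (z (i / M k)) (i % M k)) = true) ↔ n % M k = 2
  ty_first : ∀ k s, ty k (τ k s 0) = ty (k + 1) s
  ty_last : ∀ k s, ty k (τ k s (M k - 1)) = ty (k + 1) s
  pairs : ∀ k s a b, ∃ i : ℤ, 0 ≤ i ∧ i + 1 < M k ∧ τ k s i = a ∧ τ k s (i + 1) = b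
  interior : ∀ k s t, (∀ i : ℤ, 1 ≤ i → i ≤ M k - 2 → τ k s i = τ k t i) → s = t

namespace BlockSystem

variable {m : ℕ} (S : BlockSystem.{u} m)

instance instFiniteLabel (k : ℕ) : Finite (S.L k) := S.finite k

instance instTopologyLabel (k : ℕ) : TopologicalSpace (S.L k) := ⊥

instance instDiscreteLabel (k : ℕ) : DiscreteTopology (S.L k) := ⟨rfl⟩

instance instNonemptyLabel (k : ℕ) : Nonempty (S.L k) := ⟨(S.ty_surj k true).choose⟩

/-- The substitution applied to a bi-infinite sequence. -/
def sub (k : ℕ) (z : ℤ → S.L (k + 1)) (n : ℤ) : S.L k := S.τ k (z (n / S.M k)) (n % S.M k)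

/-- The length of the words over the alphabet `Fin m` coded by the letters of level `k`. -/
def len : ℕ → ℕ
  | 0 => 1
  | k + 1 => len k * S.M k

/-- The sequence over `Fin m` coded by a sequence of letters of level `k`. -/
def expand : ∀ k, (ℤ → S.L k) → ℤ → Fin m
  | 0, y => fun n => S.e (y n)
  | k + 1, y => expand k (S.sub k y)

/-- The sequence `a` of letters of level `k` codes `x`, with a block starting at position `o`. -/
def Dec (k : ℕ) (x : ℤ → Fin m) (o : ℤ) (a : ℤ → S.L k) : Prop :=
  ∀ n, x (n + o) = S.expand k a n

theorem M_pos (k : ℕ) : (0 : ℤ) < S.M k := by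
  have := S.three_le_M k
  omega

theorem two_pow_le_len (k : ℕ) : 2 ^ k ≤ S.len k := by
  induction k with
  | zero => simp [len]
  | succ k ih =>
    rw [pow_succ, len]
    exact Nat.mul_le_mul ih (le_of_lt (S.three_le_M k))

theorem len_pos (k : ℕ) : (0 : ℤ) < S.len k := by
  have := S.two_pow_le_len k
  have h : 0 < 2 ^ k := by positivity
  omega

theorem sub_add (k : ℕ) (z : ℤ → S.L (k + 1)) (q p : ℤ) (h0 : 0 ≤ p) (h1 : p < S.M k) :
    S.sub k z (q * S.M k + p) = S.τ k (z q) p := by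
  have hM := S.M_pos k
  have h2 : (q * S.M k + p) / S.M k = q := by
    rw [add_comm, Int.add_mul_ediv_right _ _ hM.ne', Int.ediv_eq_zero_of_lt h0 h1, zero_add]
  have h3 : (q * S.M k + p) % S.M k = p := by
    rw [add_comm, Int.add_mul_emod_self_right, Int.emod_eq_of_lt h0 h1]
  rw [sub, h2, h3]

theorem sub_shift (k : ℕ) (z : ℤ → S.L (k + 1)) (c n : ℤ) :
    S.sub k (fun i => z (i + c)) n = S.sub k z (n + c * S.M k) := by
  have hM := S.M_pos k
  simp only [sub]
  rw [Int.add_mul_ediv_right _ _ hM.ne', Int.add_mul_emod_self_right]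

theorem expand_congr (k : ℕ) (y y' : ℤ → S.L k) (q q' p : ℤ) (h0 : 0 ≤ p) (h1 : p < S.len k)
    (h : y q = y' q') :
    S.expand k y (q * S.len k + p) = S.expand k y' (q' * S.len k + p) := by
  induction k generalizing q q' p with
  | zero =>
    have h1 : p < ((1 : ℕ) : ℤ) := h1
    have : p = 0 := by omega
    subst this
    simp [expand, len, h]
  | succ k ih =>
    have hl := S.len_pos k
    have hM := S.M_pos k
    simp only [len, Nat.cast_mul] at h1 ⊢
    have e1 : p = p / S.len k * S.len k + p % S.len k := by
      rw [mul_comm]; exact (Int.mul_ediv_add_emod p _).symm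
    have h3 : 0 ≤ p / S.len k := Int.ediv_nonneg h0 hl.le
    have h4 : p / S.len k < S.M k := by
      rw [Int.ediv_lt_iff_lt_mul hl]; linarith
    have key := ih (S.sub k y) (S.sub k y') (q * S.M k + p / S.len k)
      (q' * S.M k + p / S.len k) (p % S.len k) (Int.emod_nonneg _ hl.ne')
      (Int.emod_lt_of_pos _ hl) (by rw [S.sub_add k y q _ h3 h4, S.sub_add k y' q' _ h3 h4, h])
    simp only [expand]
    convert key using 2 <;> linarith

theorem expand_shift (k : ℕ) (y : ℤ → S.L k) (c n : ℤ) :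
    S.expand k (fun i => y (i + c)) n = S.expand k y (n + c * S.len k) := by
  induction k generalizing c n with
  | zero => simp [expand, len]
  | succ k ih =>
    have h : S.sub k (fun i => y (i + c)) = fun i => S.sub k y (i + c * S.M k) :=
      funext fun i => S.sub_shift k y c i
    simp only [expand, len, Nat.cast_mul]
    rw [h, ih]
    congr 1
    ring

/-- The marker at position 2 of a block of `z'` is also a marker in the image of `z`, so `M k`
divides `d`; the letters are then recovered from the interiors of their images. -/
theorem sub_recognizable (k : ℕ) (z z' : ℤ → S.L (k + 1)) (d : ℤ)
    (h : ∀ n, S.sub k z (n + d) = S.sub k z' n) :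
    ∃ c, d = c * S.M k ∧ ∀ n, z' n = z (n + c) := by
  have hM := S.M_pos k
  have h2 : (2 : ℤ) % S.M k = 2 :=
    Int.emod_eq_of_lt (by norm_num) (by have := S.three_le_M k; omega)
  have h3 := (S.mark k z' 2).2 h2
  have h4 : (2 + d) % S.M k = 2 := by
    rw [← S.mark k z]
    intro i h5 h6
    have h7 := h3 (i - d) (by linarith) (by linarith)
    have h8 := h (i - d)
    rw [sub_add_cancel] at h8
    change S.ty k (S.sub k z' (i - d)) = true at h7
    rw [← h8] at h7
    exact h7
  have h5 : (S.M k : ℤ) ∣ d := by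
    have h6 : (2 + d) % S.M k = 2 % S.M k := by rw [h4, h2]
    have h8 : (S.M k : ℤ) ∣ (2 + d) - 2 := (Int.ModEq.dvd (Int.ModEq.symm h6))
    simpa using h8
  obtain ⟨c, rfl⟩ := h5
  refine ⟨c, mul_comm _ _, fun n => S.interior k _ _ fun i h6 h7 => ?_⟩
  have h8 := h (n * S.M k + i)
  rw [S.sub_add k z' n i (by linarith) (by linarith)] at h8
  rw [← h8, ← S.sub_add k z (n + c) i (by linarith) (by linarith)]
  congr 1
  ring

theorem expand_recognizable (k : ℕ) (y y' : ℤ → S.L k) (d : ℤ)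
    (h : ∀ n, S.expand k y (n + d) = S.expand k y' n) :
    ∃ c, d = c * S.len k ∧ ∀ n, y' n = y (n + c) := by
  induction k generalizing d with
  | zero => exact ⟨d, by simp [len], fun n => (S.e.injective (h n)).symm⟩
  | succ k ih =>
    obtain ⟨c, hc, h1⟩ := ih (S.sub k y) (S.sub k y') d h
    obtain ⟨c', hc', h2⟩ := S.sub_recognizable k y y' c fun n => (h1 n).symm
    exact ⟨c', by rw [hc, hc', len]; push_cast; ring, h2⟩

variable {S}

theorem Dec.unique {k : ℕ} {x : ℤ → Fin m} {o o' : ℤ} {a a' : ℤ → S.L k} (h : S.Dec k x o a)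
    (h' : S.Dec k x o' a') : ∃ c, o' = o + c * S.len k ∧ ∀ n, a' n = a (n + c) := by
  obtain ⟨c, hc, h1⟩ := S.expand_recognizable k a a' (o' - o) fun n => by
    rw [← h, ← h']
    congr 1
    ring
  exact ⟨c, by linarith, h1⟩

theorem Dec.unique_seq {k : ℕ} {x : ℤ → Fin m} {o : ℤ} {a a' : ℤ → S.L k} (h : S.Dec k x o a)
    (h' : S.Dec k x o a') : a' = a := by
  obtain ⟨c, hc, h1⟩ := h.unique h'
  have hl := S.len_pos k
  have h2 : c * S.len k = 0 := by linarith
  rcases mul_eq_zero.1 h2 with h3 | h3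
  · subst h3
    funext n
    simpa using h1 n
  · exact absurd h3 hl.ne'

theorem Dec.eq {k : ℕ} {x x' : ℤ → Fin m} {o : ℤ} {a : ℤ → S.L k} (h : S.Dec k x o a)
    (h' : S.Dec k x' o a) : x = x' := by
  funext n
  have h1 := h (n - o)
  rw [← h' (n - o), sub_add_cancel] at h1
  exact h1

theorem Dec.pred {k : ℕ} {x : ℤ → Fin m} {o : ℤ} {a : ℤ → S.L (k + 1)} (h : S.Dec (k + 1) x o a) :
    S.Dec k x o (S.sub k a) := h

theorem Dec.lower {j k : ℕ} (hjk : j ≤ k) {x : ℤ → Fin m} {o : ℤ} {a : ℤ → S.L k}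
    (h : S.Dec k x o a) : ∃ b, S.Dec j x o b := by
  induction k, hjk using Nat.le_induction with
  | base => exact ⟨a, h⟩
  | succ k _ ih => exact ih h.pred

theorem Dec.add_mul {k : ℕ} {x : ℤ → Fin m} {o : ℤ} {a : ℤ → S.L k} (h : S.Dec k x o a) (c : ℤ) :
    S.Dec k x (o + c * S.len k) fun n => a (n + c) := by
  intro n
  rw [expand_shift, ← h]
  congr 1
  ring

theorem Dec.shift {k : ℕ} {x : ℤ → Fin m} {o : ℤ} {a : ℤ → S.L k} (h : S.Dec k x o a) (t : ℤ) :
    S.Dec k (shift t x) (o - t) a := by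
  intro n
  rw [← h]
  change x (t + (n + (o - t))) = _
  congr 1
  ring

theorem dec_iff {k : ℕ} {x : ℤ → Fin m} {o : ℤ} {a : ℤ → S.L k} :
    S.Dec k x o a ↔ (fun n => S.expand k a (n - o)) = x := by
  constructor
  · intro h
    funext n
    rw [← h, sub_add_cancel]
  · rintro rfl n
    simp

theorem Dec.exists_reduced {k : ℕ} {x : ℤ → Fin m} {o : ℤ} {a : ℤ → S.L k} (h : S.Dec k x o a) :
    S.Dec k x (o % S.len k) fun n => a (n + -(o / S.len k)) := by
  convert h.add_mul (-(o / S.len k)) using 1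
  have := Int.emod_add_mul_ediv o (S.len k)
  linarith

theorem Dec.apply {k : ℕ} {x : ℤ → Fin m} {o : ℤ} {a : ℤ → S.L k} (h : S.Dec k x o a) (n : ℤ) :
    x n = S.expand k a (n - o) := by
  rw [← h, sub_add_cancel]

/-! ### The subshift: compactness, minimality and complexity -/

variable (S)

theorem continuous_expand (k : ℕ) (n : ℤ) : Continuous fun y : ℤ → S.L k => S.expand k y n := by
  induction k generalizing n with
  | zero =>
    exact (continuous_of_discreteTopology (f := S.e)).comp (continuous_apply n)
  | succ k ih =>
    refine (ih n).comp (continuous_pi fun i => ?_)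
    exact (continuous_of_discreteTopology (f := fun s => S.τ k s (i % S.M k))).comp
      (continuous_apply (i / (S.M k : ℤ)))

/-- The offset matters only modulo `len k`, so this is a finite union of continuous images of a
compact space. -/
theorem isCompact_level (k : ℕ) : IsCompact {x | ∃ o a, S.Dec k x o a} := by
  have h : {x | ∃ o a, S.Dec k x o a} =
      ⋃ o : Fin (S.len k), Set.range fun a : ℤ → S.L k => fun n => S.expand k a (n - (o : ℕ)) := by
    ext x
    simp only [Set.mem_ofPred_eq, Set.mem_iUnion, Set.mem_range]
    constructor
    · rintro ⟨o, a, h⟩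
      have hl := S.len_pos k
      have h1 := Int.emod_nonneg o hl.ne'
      have h2 := Int.emod_lt_of_pos o hl
      refine ⟨⟨(o % S.len k).toNat, by omega⟩, fun n => a (n + -(o / S.len k)), ?_⟩
      rw [← dec_iff]
      simpa [Int.toNat_of_nonneg h1] using h.exists_reduced
    · rintro ⟨o, a, h⟩
      exact ⟨(o : ℕ), a, dec_iff.2 h⟩
  rw [h]
  exact isCompact_iUnion fun o =>
    isCompact_range (continuous_pi fun n => S.continuous_expand k _)

/-- The subshift generated by the directive sequence. -/
def X : Subshift (Fin m) ℤ where
  carrier := {x | ∀ k, ∃ o a, S.Dec k x o a}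
  isClosed := by
    rw [Set.ofPred_forall]
    exact isClosed_iInter fun k => (S.isCompact_level k).isClosed
  mapsTo t x hx k := by
    obtain ⟨o, a, h⟩ := hx k
    exact ⟨o - t, a, h.shift t⟩

theorem mem_X {x : ℤ → Fin m} : x ∈ S.X.carrier ↔ ∀ k, ∃ o a, S.Dec k x o a := Iff.rfl

theorem X_nonempty : S.X.carrier.Nonempty := by
  have h : S.X.carrier = ⋂ k, {x | ∃ o a, S.Dec k x o a} := by
    ext x
    simp [mem_X]
  rw [h]
  refine IsCompact.nonempty_iInter_of_sequence_nonempty_isCompact_isClosed _ ?_ ?_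
    (S.isCompact_level 0) fun k => (S.isCompact_level k).isClosed
  · rintro k x ⟨o, a, h⟩
    exact ⟨o, _, h.pred⟩
  · intro k
    obtain ⟨s⟩ := S.instNonemptyLabel k
    exact ⟨_, 0, fun _ => s, dec_iff.2 rfl⟩

theorem exists_pair (k : ℕ) (z : ℤ → S.L (k + 1)) (a b : S.L k) :
    ∃ i, S.sub k z i = a ∧ S.sub k z (i + 1) = b := by
  obtain ⟨i, h0, h1, h2, h3⟩ := S.pairs k (z 0) a b
  refine ⟨i, ?_, ?_⟩
  · rw [← h2, ← S.sub_add k z 0 i h0 (by linarith)]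
    simp
  · rw [← h3, ← S.sub_add k z 0 (i + 1) (by linarith) h1]
    simp

variable {S}

/-- By uniqueness of the decoding, `a` is a translate of the image of a sequence of level `k + 1`,
and every single image word contains all pairs. -/
theorem Dec.exists_pair {k : ℕ} {x : ℤ → Fin m} (hx : x ∈ S.X.carrier) {o : ℤ} {a : ℤ → S.L k}
    (h : S.Dec k x o a) (s t : S.L k) : ∃ i, a i = s ∧ a (i + 1) = t := by
  obtain ⟨o', z, hz⟩ := hx (k + 1)
  obtain ⟨c, -, h1⟩ := h.unique hz.pred
  obtain ⟨i, h2, h3⟩ := S.exists_pair k z s t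
  refine ⟨i + c, ?_, ?_⟩
  · rw [← h1, h2]
  · rw [add_right_comm, ← h1, h3]

variable (S)

/-- The word of length `n` at position `p` of the concatenation of two words of level `k`. -/
noncomputable def pairWord (k n : ℕ) (s t : S.L k) (p : ℕ) (j : Fin n) : Fin m :=
  S.expand k (fun i => if i = 0 then s else t) (p + (j : ℕ))

variable {S}

theorem Dec.apply_pair {k n : ℕ} (hn : n ≤ S.len k) {x : ℤ → Fin m} {o : ℤ} {a : ℤ → S.L k}
    (h : S.Dec k x o a) (q : ℤ) (p : ℕ) (hp : p < S.len k) (j : Fin n) :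
    x (o + q * S.len k + p + (j : ℕ)) = S.pairWord k n (a q) (a (q + 1)) p j := by
  have hj := j.2
  rw [h.apply, pairWord]
  by_cases hlt : p + (j : ℕ) < S.len k
  · have := S.expand_congr k a (fun i => if i = 0 then a q else a (q + 1)) q 0 (p + (j : ℕ))
      (by positivity) (by exact_mod_cast hlt) (by simp)
    convert this using 2 <;> ring
  · have := S.expand_congr k a (fun i => if i = 0 then a q else a (q + 1)) (q + 1) 1
      (p + (j : ℕ) - S.len k) (by omega) (by omega) (by simp)
    convert this using 2 <;> ring

theorem exists_pairWord {k n : ℕ} (hn : n ≤ S.len k) {x : ℤ → Fin m} (hx : x ∈ S.X.carrier)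
    (i : ℤ) : ∃ s t, ∃ p < S.len k, ∀ j : Fin n, x (i + (j : ℕ)) = S.pairWord k n s t p j := by
  obtain ⟨o, a, h⟩ := hx k
  have hl := S.len_pos k
  have h1 := Int.emod_nonneg (i - o) hl.ne'
  have h2 := Int.emod_lt_of_pos (i - o) hl
  refine ⟨a ((i - o) / S.len k), a ((i - o) / S.len k + 1), ((i - o) % S.len k).toNat, by omega,
    fun j => ?_⟩
  rw [← h.apply_pair hn _ _ (by omega)]
  congr 1
  rw [Int.toNat_of_nonneg h1]
  have := Int.emod_add_mul_ediv (i - o) (S.len k)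
  linarith

theorem exists_occurrence {k n : ℕ} (hn : n ≤ S.len k) {x : ℤ → Fin m} (hx : x ∈ S.X.carrier)
    (s t : S.L k) (p : ℕ) (hp : p < S.len k) :
    ∃ i : ℤ, ∀ j : Fin n, x (i + (j : ℕ)) = S.pairWord k n s t p j := by
  obtain ⟨o, a, h⟩ := hx k
  obtain ⟨q, rfl, rfl⟩ := h.exists_pair hx s t
  exact ⟨o + q * S.len k + p, h.apply_pair hn q p hp⟩

variable (S)

theorem isMinimal : TwoSidedSubshift.IsMinimal S.X := by
  refine ⟨S.X_nonempty, ?_⟩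
  rintro n w ⟨x, hx, i, hi⟩ x' hx'
  have hn : n ≤ S.len n := (Nat.lt_two_pow_self).le.trans (S.two_pow_le_len n)
  obtain ⟨s, t, p, hp, h⟩ := exists_pairWord hn hx i
  obtain ⟨i', h'⟩ := exists_occurrence hn hx' s t p hp
  exact ⟨i', fun j => by rw [h', ← h, hi]⟩

/-- A word of length at most `len k` is determined by two adjacent letters of level `k` and its
position in the first block. -/
theorem complexity_le {k n : ℕ} (hn : n ≤ S.len k) :
    TwoSidedSubshift.complexity S.X n ≤ Nat.card (S.L k) ^ 2 * S.len k := by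
  let F : S.L k × S.L k × Fin (S.len k) → Fin n → Fin m :=
    fun v => S.pairWord k n v.1 v.2.1 v.2.2
  have h : TwoSidedSubshift.language S.X n ⊆ Set.range F := by
    rintro w ⟨x, hx, i, hi⟩
    obtain ⟨s, t, p, hp, h⟩ := exists_pairWord hn hx i
    exact ⟨⟨s, t, p, hp⟩, funext fun j => by rw [← hi, h]⟩
  calc TwoSidedSubshift.complexity S.X n ≤ (Set.range F).ncard :=
        Set.ncard_le_ncard h (Set.finite_range F)
    _ ≤ Nat.card (S.L k × S.L k × Fin (S.len k)) := by
        rw [← Set.image_univ, ← Set.ncard_univ]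
        exact Set.ncard_image_le
    _ = _ := by
        rw [Nat.card_prod, Nat.card_prod, Nat.card_fin]
        ring

/-- A point of `X` contains every pattern of every other point. -/
theorem exists_window {x x' : ℤ → Fin m} (hx : x ∈ S.X.carrier) (hx' : x' ∈ S.X.carrier)
    (n r : ℤ) : ∃ i, ∀ j, -r ≤ j → j ≤ r → x' (i + j) = x (n + j) := by
  have hmin := S.isMinimal.2 (2 * r + 1).toNat
    (fun j => x (n - r + (j : ℕ))) ⟨x, hx, n - r, fun _ => rfl⟩ x' hx'
  obtain ⟨i, hi⟩ := hmin
  refine ⟨i + r, fun j h1 h2 => ?_⟩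
  have h3 := hi ⟨(j + r).toNat, by omega⟩
  simp only [Int.toNat_of_nonneg (by linarith : 0 ≤ j + r)] at h3
  convert h3 using 2 <;> ring

end BlockSystem

/-! ### Automorphisms as sliding block codes -/

namespace TwoSidedSubshift

variable {m : ℕ} {X : Subshift (Fin m) ℤ}

theorem sigmaAut_zpow_apply (t : ℤ) (x : X.carrier) :
    (((sigmaAut X) ^ t).1 x).1 = shift t x.1 := by
  induction t generalizing x with
  | zero =>
    funext n
    change x.1 n = x.1 (0 + n)
    rw [zero_add]
  | succ t ih =>
    rw [zpow_add_one]
    refine (ih (sigma X x)).trans ?_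
    funext n
    exact congrArg x.1 (by ring : (1 : ℤ) + (t + n) = t + 1 + n)
  | pred t ih =>
    rw [zpow_sub_one]
    refine (ih ((sigma X).symm x)).trans ?_
    funext n
    exact congrArg x.1 (by ring : (-1 : ℤ) + (-t + n) = -t - 1 + n)

theorem aut_shift (φ : Aut X) (t n : ℤ) (x x' : X.carrier) (h : x'.1 = shift t x.1) :
    (φ.1 x').1 n = (φ.1 x).1 (t + n) := by
  have hx : x' = ((sigmaAut X) ^ t).1 x := Subtype.ext (by rw [h, sigmaAut_zpow_apply])
  have hc : Commute φ (sigmaAut X) := Subtype.ext (Homeomorph.ext fun x => φ.2 x)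
  have h2 := congrArg (fun ψ : Aut X => (ψ.1 x).1 n) (hc.zpow_right t).eq
  have h3 : ((((sigmaAut X) ^ t).1 (φ.1 x))).1 n = (φ.1 x).1 (t + n) := by
    rw [sigmaAut_zpow_apply]
    rfl
  rw [hx, ← h3]
  exact h2

/-- The Curtis–Hedlund–Lyndon theorem: an automorphism is given by a sliding block rule. -/
theorem exists_radius (φ : Aut X) : ∃ r : ℤ, 0 ≤ r ∧ ∀ (x x' : X.carrier) (n n' : ℤ),
    (∀ j, -r ≤ j → j ≤ r → x.1 (n + j) = x'.1 (n' + j)) → (φ.1 x).1 n = (φ.1 x').1 n' := by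
  have : CompactSpace X.carrier := isCompact_iff_compactSpace.1 X.isClosed.isCompact
  have hφ : Continuous fun p : X.carrier × X.carrier => ((φ.1 p.1).1 0, (φ.1 p.2).1 0) :=
    (((continuous_apply 0).comp continuous_subtype_val).comp
      (φ.1.continuous.comp continuous_fst)).prodMk
    (((continuous_apply 0).comp continuous_subtype_val).comp
      (φ.1.continuous.comp continuous_snd))
  have hK : IsCompact {p : X.carrier × X.carrier | (φ.1 p.1).1 0 ≠ (φ.1 p.2).1 0} :=
    ((isClosed_discrete {q : Fin m × Fin m | q.1 ≠ q.2}).preimage hφ).isCompact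
  -- The sets of pairs agreeing on `[-r, r]` decrease to the diagonal, which misses the compact set
  -- `hK`; hence one of them already does.
  obtain ⟨r, hr⟩ := hK.elim_directed_family_closed
    (fun r : ℕ => {p : X.carrier × X.carrier | ∀ j : ℤ, -(r : ℤ) ≤ j → j ≤ r → p.1.1 j = p.2.1 j})
    (fun r => by
      simp only [Set.ofPred_forall]
      refine isClosed_iInter fun j => isClosed_iInter fun _ => isClosed_iInter fun _ => ?_
      exact isClosed_eq
        (((continuous_apply j).comp continuous_subtype_val).comp continuous_fst)
        (((continuous_apply j).comp continuous_subtype_val).comp continuous_snd))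
    (by
      ext ⟨x, x'⟩
      simp only [Set.mem_inter_iff, Set.mem_iInter, Set.mem_ofPred_eq, Set.mem_empty_iff_false,
        iff_false, not_and]
      intro h1 h2
      have : x = x' := Subtype.ext (funext fun j => h2 j.natAbs j (by omega) (by omega))
      exact h1 (by rw [this]))
    (directed_of_isDirected_le fun r s hrs p hp j h1 h2 => hp j (by omega) (by omega))
  refine ⟨r, by positivity, fun x x' n n' h => ?_⟩
  by_contra hne
  have hmem : ((⟨shift n x.1, X.mapsTo n x.2⟩, ⟨shift n' x'.1, X.mapsTo n' x'.2⟩) :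
      X.carrier × X.carrier) ∈ {p : X.carrier × X.carrier | (φ.1 p.1).1 0 ≠ (φ.1 p.2).1 0} ∩
      {p : X.carrier × X.carrier | ∀ j : ℤ, -(r : ℤ) ≤ j → j ≤ r → p.1.1 j = p.2.1 j} := by
    refine ⟨?_, h⟩
    change (φ.1 _).1 0 ≠ (φ.1 _).1 0
    rw [aut_shift φ n 0 x _ rfl, aut_shift φ n' 0 x' _ rfl]
    simpa using hne
  rw [hr] at hmem
  exact hmem

end TwoSidedSubshift

/-! ### Automorphisms preserve blocks up to a shift and relabel letters -/

namespace BlockSystem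

open TwoSidedSubshift

variable {m : ℕ} (S : BlockSystem.{u} m)

theorem ty_expand_first (k : ℕ) (y : ℤ → S.L k) (i : ℤ) :
    S.ty 0 (S.e.symm (S.expand k y (i * S.len k))) = S.ty k (y i) := by
  induction k generalizing i with
  | zero => simp [expand, len]
  | succ k ih =>
    have h := S.sub_add k y i 0 le_rfl (S.M_pos k)
    rw [add_zero] at h
    rw [← S.ty_first, ← h, ← ih]
    simp only [expand, len]
    congr 3
    push_cast
    ring

theorem ty_expand_last (k : ℕ) (y : ℤ → S.L k) (i : ℤ) :
    S.ty 0 (S.e.symm (S.expand k y ((i + 1) * S.len k - 1))) = S.ty k (y i) := by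
  induction k generalizing i with
  | zero => simp [expand, len]
  | succ k ih =>
    have hM := S.M_pos k
    have h := S.sub_add k y i (S.M k - 1) (by linarith) (by linarith)
    rw [← S.ty_last, ← h, ← ih]
    simp only [expand, len]
    congr 3
    push_cast
    ring

/-- Recognizability applied to the two constant sequences with values `y q` and `y' q'`. -/
theorem expand_inj (k : ℕ) (y y' : ℤ → S.L k) (q q' : ℤ)
    (h : ∀ p : ℤ, 0 ≤ p → p < S.len k →
      S.expand k y (q * S.len k + p) = S.expand k y' (q' * S.len k + p)) : y q = y' q' := by
  have hl := S.len_pos k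
  obtain ⟨c, -, hc⟩ := S.expand_recognizable k (fun _ => y q) (fun _ => y' q') 0 fun n => by
    have h1 := Int.emod_nonneg n hl.ne'
    have h2 := Int.emod_lt_of_pos n hl
    have h3 : n = n / S.len k * S.len k + n % S.len k := by
      rw [mul_comm]; exact (Int.mul_ediv_add_emod n _).symm
    rw [add_zero, h3, S.expand_congr k (fun _ => y q) y _ q _ h1 h2 rfl,
      S.expand_congr k (fun _ => y' q') y' _ q' _ h1 h2 rfl, h _ h1 h2]
  exact (hc 0).symm

variable {S}

/-- An automorphism moves the block structure of every level by at most its radius: otherwise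
the type of an image block could be read off from each of two consecutive blocks. -/
theorem exists_small_offset {φ : Aut S.X} {r : ℤ}
    (hr : ∀ (x x' : S.X.carrier) (n n' : ℤ),
      (∀ j, -r ≤ j → j ≤ r → x.1 (n + j) = x'.1 (n' + j)) → (φ.1 x).1 n = (φ.1 x').1 n')
    {k : ℕ} (x : S.X.carrier) {o : ℤ} {a : ℤ → S.L k} (h : S.Dec k x.1 o a) :
    ∃ d, -r ≤ d ∧ d ≤ r ∧ ∃ c, S.Dec k (φ.1 x).1 (o + d) c := by
  obtain ⟨o', c, hc⟩ := (φ.1 x).2 k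
  have hl := S.len_pos k
  have h0 := Int.emod_nonneg (o' - o) hl.ne'
  have h1 := Int.emod_lt_of_pos (o' - o) hl
  have hd : ∃ c, S.Dec k (φ.1 x).1 (o + (o' - o) % S.len k) c := by
    refine ⟨fun n => c (n + -((o' - o) / S.len k)), ?_⟩
    convert hc.add_mul (-((o' - o) / S.len k)) using 1
    have := Int.emod_add_mul_ediv (o' - o) (S.len k)
    linarith
  clear hc
  generalize (o' - o) % (S.len k : ℤ) = d at h0 h1 hd
  obtain ⟨c, hc⟩ := hd
  by_cases hd1 : d ≤ r
  · exact ⟨d, by linarith, hd1, c, hc⟩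
  by_cases hd2 : S.len k - r ≤ d
  · refine ⟨d - S.len k, by linarith, by linarith, fun n => c (n + -1), ?_⟩
    convert hc.add_mul (-1) using 1
    ring
  exfalso
  push Not at hd1 hd2
  -- As `r < d < len k - r`, the window of radius `r` around the first position of image block `i`
  -- lies in the block of `a i`, and the window around its last position lies in the block of `a (i
  -- + 1)`.
  have hfirst : ∀ i i', a i = a i' → S.ty k (c i) = S.ty k (c i') := by
    intro i i' hii
    rw [← S.ty_expand_first, ← S.ty_expand_first, ← hc, ← hc]
    congr 2
    apply hr
    intro j hj1 hj2
    rw [h.apply, h.apply]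
    convert S.expand_congr k a a i i' (d + j) (by linarith) (by linarith) hii using 2 <;> ring
  have hlast : ∀ i i', a (i + 1) = a (i' + 1) → S.ty k (c i) = S.ty k (c i') := by
    intro i i' hii
    rw [← S.ty_expand_last, ← S.ty_expand_last, ← hc, ← hc]
    congr 2
    apply hr
    intro j hj1 hj2
    rw [h.apply, h.apply]
    convert S.expand_congr k a a (i + 1) (i' + 1) (d - 1 + j) (by linarith) (by linarith) hii
      using 2 <;> ring
  obtain ⟨s, hs⟩ := S.ty_surj k true
  obtain ⟨t, ht⟩ := S.ty_surj k false
  obtain ⟨i, hi1, hi2⟩ := hc.exists_pair (φ.1 x).2 s t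
  -- Where `a i` is followed directly by `a (i + 2)`, the image block has the type of `c i` by its
  -- first letter and that of `c (i + 1)` by its last.
  obtain ⟨j, hj1, hj2⟩ := h.exists_pair x.2 (a i) (a (i + 1 + 1))
  have h2 := hfirst j i hj1
  have h3 := hlast j (i + 1) hj2
  rw [h2, hi1, hi2, hs, ht] at h3
  exact absurd h3 (by decide)

/-- Up to a power of the shift, an automorphism preserves the block structure of a given point at
all large levels. -/
theorem exists_offset (φ : Aut S.X) (x : S.X.carrier) :
    ∃ (D : ℤ) (K : ℕ), ∀ k ≥ K, ∀ o a, S.Dec k x.1 o a →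
      ∃ c, S.Dec k (φ.1 x).1 (o + D) c := by
  obtain ⟨r, hr0, hr⟩ := exists_radius φ
  -- Offsets in `[-r, r]` that agree modulo `len K` are then equal, and block boundaries of a higher
  -- level are also boundaries of level `K`.
  have hK : 2 * r < S.len (2 * r).toNat := by
    have h1 := S.two_pow_le_len (2 * r).toNat
    have h2 : (2 * r).toNat < 2 ^ (2 * r).toNat := Nat.lt_two_pow_self
    omega
  generalize (2 * r).toNat = K at hK
  obtain ⟨o₁, a₁, h₁⟩ := x.2 K
  obtain ⟨D, hD1, hD2, c₁, hc₁⟩ := exists_small_offset hr x h₁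
  refine ⟨D, K, fun k hk o a h => ?_⟩
  obtain ⟨d, hd1, hd2, c, hc⟩ := exists_small_offset hr x h
  obtain ⟨_, h2⟩ := h.lower hk
  obtain ⟨_, hc2⟩ := hc.lower hk
  obtain ⟨e, he, -⟩ := h₁.unique h2
  obtain ⟨e', he', -⟩ := hc₁.unique hc2
  have h3 : d - D = (S.len K : ℤ) * (e' - e) := by linarith
  have h4 : d - D = 0 :=
    Int.eq_zero_of_abs_lt_dvd (m := (S.len K : ℤ)) ⟨e' - e, h3⟩
      (abs_lt.2 ⟨by linarith, by linarith⟩)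
  rw [← sub_eq_zero.1 h4]
  exact ⟨c, hc⟩

theorem exists_relabeling_level {φ : Aut S.X} {r : ℤ}
    (hr : ∀ (x x' : S.X.carrier) (n n' : ℤ),
      (∀ j, -r ≤ j → j ≤ r → x.1 (n + j) = x'.1 (n' + j)) → (φ.1 x).1 n = (φ.1 x').1 n')
    {k : ℕ} (hk : r ≤ S.len k) (x : S.X.carrier)
    (hφ : ∀ o a, S.Dec (k + 1) x.1 o a → ∃ c, S.Dec (k + 1) (φ.1 x).1 o c) :
    ∃ π : S.L (k + 1) → S.L (k + 1), ∀ o a, S.Dec (k + 1) x.1 o a →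
      S.Dec (k + 1) (φ.1 x).1 o fun i => π (a i) := by
  obtain ⟨o, a, h⟩ := x.2 (k + 1)
  obtain ⟨c, hc⟩ := hφ o a h
  have hM := S.M_pos k
  have hl := S.len_pos k
  have key : ∀ i i', a i = a i' → c i = c i' := by
    intro i i' hii
    -- Interior subblocks are at distance at least `len k ≥ r` from the ends of the block, so the
    -- block rule sees only the letter `a i` there.
    refine S.interior k _ _ fun p hp1 hp2 => ?_
    rw [← S.sub_add k c i p (by linarith) (by linarith),
      ← S.sub_add k c i' p (by linarith) (by linarith)]
    refine S.expand_inj k _ _ _ _ fun u hu1 hu2 => ?_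
    rw [← hc.pred, ← hc.pred]
    apply hr
    intro j hj1 hj2
    rw [h.apply, h.apply]
    have h1 : 1 * (S.len k : ℤ) ≤ p * S.len k := mul_le_mul_of_nonneg_right hp1 hl.le
    have h2 : p * (S.len k : ℤ) ≤ (S.M k - 2) * S.len k := mul_le_mul_of_nonneg_right hp2 hl.le
    convert S.expand_congr (k + 1) a a i i' (p * S.len k + u + j) (by linarith)
      (by rw [len]; push_cast; linarith) hii using 2 <;> rw [len] <;> push_cast <;> ring
  have hsurj : ∀ s, ∃ i, a i = s := fun s => by
    obtain ⟨i, hi, -⟩ := h.exists_pair x.2 s s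
    exact ⟨i, hi⟩
  choose g hg using hsurj
  refine ⟨fun s => c (g s), fun o' a' h' => ?_⟩
  obtain ⟨e, rfl, he⟩ := h.unique h'
  convert hc.add_mul e using 2 with i
  exact key _ _ (by rw [hg, he])

/-- Up to a power of the shift, an automorphism acts on a given point by relabeling the letters of
all large levels. -/
theorem exists_relabeling (φ : Aut S.X) (x : S.X.carrier) :
    ∃ (D : ℤ) (k : ℕ) (π : ∀ j, S.L j → S.L j), ∀ j ≥ k, ∀ o a, S.Dec j x.1 o a →
      S.Dec j ((sigmaAut S.X ^ D * φ).1 x).1 o fun i => π j (a i) := by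
  obtain ⟨D, K, hD⟩ := exists_offset φ x
  obtain ⟨r, hr0, hr⟩ := exists_radius (sigmaAut S.X ^ D * φ)
  have hψ : ((sigmaAut S.X ^ D * φ).1 x).1 = shift D (φ.1 x).1 :=
    sigmaAut_zpow_apply D (φ.1 x)
  have h : ∀ k, ∃ π : S.L k → S.L k, k ≥ max K r.toNat + 1 → ∀ o a, S.Dec k x.1 o a →
      S.Dec k ((sigmaAut S.X ^ D * φ).1 x).1 o fun i => π (a i) := by
    intro k
    by_cases hk : k ≥ max K r.toNat + 1
    · obtain ⟨k, rfl⟩ : ∃ k', k = k' + 1 := ⟨k - 1, by omega⟩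
      have h1 := S.two_pow_le_len k
      have h2 : k < 2 ^ k := Nat.lt_two_pow_self
      obtain ⟨π, hπ⟩ := exists_relabeling_level hr (k := k) (by omega) x fun o a h => by
        obtain ⟨c, hc⟩ := hD (k + 1) (by omega) o a h
        refine ⟨c, ?_⟩
        rw [hψ]
        convert hc.shift D using 1
        ring
      exact ⟨π, fun _ => hπ⟩
    · exact ⟨id, fun h => absurd h hk⟩
  choose π hπ using h
  exact ⟨D, _, π, fun j hj => hπ j hj⟩

theorem relabeling_compatible {x x' : ℤ → Fin m} (hx : x ∈ S.X.carrier) {k : ℕ}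
    {π : S.L k → S.L k} {π' : S.L (k + 1) → S.L (k + 1)}
    (h : ∀ o a, S.Dec k x o a → S.Dec k x' o fun i => π (a i))
    (h' : ∀ o a, S.Dec (k + 1) x o a → S.Dec (k + 1) x' o fun i => π' (a i))
    (s : S.L (k + 1)) (i : ℤ) (h0 : 0 ≤ i) (h1 : i < S.M k) :
    S.τ k (π' s) i = π (S.τ k s i) := by
  obtain ⟨o, a, ha⟩ := hx (k + 1)
  obtain ⟨q, rfl, -⟩ := ha.exists_pair hx s s
  have h2 := (h' o a ha).pred.unique_seq (h o _ ha.pred)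
  have h3 := congrFun h2 (q * S.M k + i)
  simp only [S.sub_add k _ q i h0 h1] at h3
  exact h3.symm

/-! ### Compatible relabelings act by automorphisms -/

/-- A family of relabelings which commute with the substitutions acts on `X`. -/
theorem exists_relabeled {K : ℕ} {π : ∀ j, S.L j → S.L j}
    (hπ : ∀ k ≥ K, ∀ s i, S.τ k (π (k + 1) s) i = π k (S.τ k s i))
    {x : ℤ → Fin m} (hx : x ∈ S.X.carrier) :
    ∃ x' ∈ S.X.carrier, ∀ k ≥ K, ∀ o a, S.Dec k x o a → S.Dec k x' o fun i => π k (a i) := by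
  obtain ⟨o, a, h⟩ := hx K
  have key : ∀ k ≥ K, ∀ o' a', S.Dec k x o' a' →
      S.Dec k (fun n => S.expand K (fun i => π K (a i)) (n - o)) o' fun i => π k (a' i) := by
    intro k hk
    induction k, hk using Nat.le_induction with
    | base =>
      intro o' a' h'
      obtain ⟨c, rfl, hc⟩ := h.unique h'
      have := (dec_iff.2 rfl : S.Dec K (fun n => S.expand K (fun i => π K (a i)) (n - o)) o
        fun i => π K (a i)).add_mul c
      simpa only [hc] using this
    | succ k hk ih =>
      intro o' a' h'
      have h1 := ih o' _ h'.pred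
      have h2 : (fun i => π k (S.sub k a' i)) = S.sub k fun i => π (k + 1) (a' i) :=
        funext fun i => (hπ k hk _ _).symm
      rw [h2] at h1
      exact h1
  refine ⟨_, fun k => ?_, key⟩
  obtain ⟨o', a', h'⟩ := hx (max k K)
  obtain ⟨b, hb⟩ := (key _ (le_max_right _ _) o' a' h').lower (le_max_left k K)
  exact ⟨o', b, hb⟩

theorem continuous_of_relabeling {k : ℕ} (π : S.L k → S.L k) (R : S.X.carrier → S.X.carrier)
    (h : ∀ (x : S.X.carrier) o a, S.Dec k x.1 o a → S.Dec k (R x).1 o fun i => π (a i)) :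
    Continuous R := by
  rw [continuous_iff_isClosed]
  intro C hC
  have hC' : IsClosed (Subtype.val '' C) := S.X.isClosed.isClosedEmbedding_subtypeVal.isClosedMap C hC
  have hcont : ∀ o : ℤ, Continuous fun (a : ℤ → S.L k) (n : ℤ) => S.expand k a (n - o) :=
    fun o => continuous_pi fun n => S.continuous_expand k _
  have hπ : Continuous fun (a : ℤ → S.L k) (i : ℤ) => π (a i) :=
    continuous_pi fun i => (continuous_of_discreteTopology (f := π)).comp (continuous_apply i)
  -- `V o` consists of the points coded with offset `o` whose relabeling lies in `C`; it is the
  -- image of a compact set of codes.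
  let V : Fin (S.len k) → Set (ℤ → Fin m) := fun o =>
    (fun (a : ℤ → S.L k) (n : ℤ) => S.expand k a (n - (o : ℕ))) ''
      {a | (fun n : ℤ => S.expand k (fun i => π (a i)) (n - (o : ℕ))) ∈ Subtype.val '' C}
  have hV : IsClosed (⋃ o, V o) :=
    isClosed_iUnion_of_finite fun o =>
      (((hC'.preimage ((hcont _).comp hπ)).isCompact).image (hcont _)).isClosed
  convert hV.preimage continuous_subtype_val using 1
  ext x
  simp only [Set.mem_preimage, Set.mem_iUnion, V, Set.mem_image, Set.mem_ofPred_eq]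
  constructor
  · intro hx
    obtain ⟨o, a, ha⟩ := x.2 k
    have hl := S.len_pos k
    have h1 := Int.emod_nonneg o hl.ne'
    have h2 := Int.emod_lt_of_pos o hl
    have h3 := ha.exists_reduced
    have h4 := h x _ _ h3
    refine ⟨⟨(o % S.len k).toNat, by omega⟩, fun n => a (n + -(o / S.len k)),
      ⟨R x, hx, ?_⟩, ?_⟩
    rotate_left
    · simp only [Int.toNat_of_nonneg h1]
      exact dec_iff.1 h3
    · simp only [Int.toNat_of_nonneg h1]
      exact (dec_iff.1 h4).symm
  · rintro ⟨o, a, ⟨y, hy, hya⟩, hxa⟩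
    have h5 := dec_iff.1 (h x _ a (dec_iff.2 hxa))
    rw [← hya] at h5
    rwa [← Subtype.ext h5]

theorem sigma_of_relabeling {k : ℕ} (π : S.L k → S.L k) (R : S.X.carrier → S.X.carrier)
    (h : ∀ (x : S.X.carrier) o a, S.Dec k x.1 o a → S.Dec k (R x).1 o fun i => π (a i))
    (x : S.X.carrier) : R (sigma S.X x) = sigma S.X (R x) := by
  obtain ⟨o, a, ha⟩ := x.2 k
  exact Subtype.ext ((h (sigma S.X x) _ _ (ha.shift 1)).eq ((h x _ _ ha).shift 1))

/-- An automorphism of `X` is determined by its value at one point. -/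
theorem aut_ext {φ ψ : Aut S.X} (x : S.X.carrier) (h : φ.1 x = ψ.1 x) : φ = ψ := by
  obtain ⟨r, hr0, hr⟩ := exists_radius φ
  obtain ⟨r', hr0', hr'⟩ := exists_radius ψ
  refine Subtype.ext (Homeomorph.ext fun y => Subtype.ext (funext fun n => ?_))
  -- By minimality the window of `y` that determines both images at `n` also occurs in `x`.
  obtain ⟨i, hi⟩ := S.exists_window y.2 x.2 n (max r r')
  have h1 := le_max_left r r'
  have h2 := le_max_right r r'
  rw [← hr x y i n fun j hj1 hj2 => hi j (by linarith) (by linarith),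
    ← hr' x y i n fun j hj1 hj2 => hi j (by linarith) (by linarith), h]

end BlockSystem

/-! ### Equivariant maps between finite subgroups, and the substitution words -/

section EquivariantMaps

variable {G : Type u} [Group G]

open Classical in
/-- Left multiplication by `g` on `K × Bool`, or the identity if `g ∉ K`. -/
noncomputable def leftMul (K : Subgroup G) (g : G) (s : K × Bool) : K × Bool :=
  if h : g ∈ K then (⟨g, h⟩ * s.1, s.2) else s

theorem leftMul_of_mem {K : Subgroup G} {g : G} (h : g ∈ K) (s : K × Bool) :
    leftMul K g s = (⟨g, h⟩ * s.1, s.2) := dif_pos h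

theorem leftMul_one (K : Subgroup G) (s : K × Bool) : leftMul K 1 s = s := by
  rw [leftMul_of_mem K.one_mem]
  exact Prod.ext (one_mul s.1) rfl

theorem leftMul_mul {K : Subgroup G} {g h : G} (hg : g ∈ K) (hh : h ∈ K) (s : K × Bool) :
    leftMul K (g * h) s = leftMul K g (leftMul K h s) := by
  rw [leftMul_of_mem hg, leftMul_of_mem hh, leftMul_of_mem (K.mul_mem hg hh)]
  exact Prod.ext (Subtype.ext (mul_assoc _ _ _)) rfl

theorem eq_one_of_leftMul_eq {K : Subgroup G} {g : G} (hg : g ∈ K) {s : K × Bool}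
    (h : leftMul K g s = s) : g = 1 := by
  rw [leftMul_of_mem hg] at h
  have h1 : (⟨g, hg⟩ : K) = 1 := mul_eq_right.1 (congrArg Prod.fst h)
  exact congrArg Subtype.val h1

/-- A map from `G` to the subgroup `K` commuting with left multiplication by elements of `K`. -/
noncomputable def retract (K : Subgroup G) (x : G) : K :=
  ⟨x * (Quotient.out (Quotient.mk (QuotientGroup.rightRel K) x))⁻¹,
    QuotientGroup.rightRel_apply.1 (Quotient.exact (Quotient.out_eq _))⟩

theorem retract_mul (K : Subgroup G) {g : G} (hg : g ∈ K) (x : G) :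
    retract K (g * x) = ⟨g, hg⟩ * retract K x := by
  have h : Quotient.mk (QuotientGroup.rightRel K) (g * x) =
      Quotient.mk (QuotientGroup.rightRel K) x :=
    Quotient.sound (QuotientGroup.rightRel_apply.2 (by simpa using hg))
  apply Subtype.ext
  simp only [retract, h, Subgroup.coe_mul, mul_assoc]

variable (K K' : Subgroup G)

/-- The maps `K' × Bool → K × Bool` commuting with left multiplication by elements of `K`. -/
@[ext]
structure EquivariantMap : Type u where
  toFun : K' × Bool → K × Bool
  map_leftMul : ∀ g ∈ K, ∀ s, toFun (leftMul K' g s) = leftMul K g (toFun s)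

namespace EquivariantMap

variable {K K'}

/-- The equivariant map twisted by a `K`-invariant function. -/
noncomputable def ofInvariant (hle : K ≤ K') (v : K' × Bool → K × Bool)
    (hv : ∀ g ∈ K, ∀ s, v (leftMul K' g s) = v s) : EquivariantMap K K' :=
  ⟨fun s => (retract K s.1 * (v s).1, (v s).2), fun g hg s => by
    simp only [hv g hg]
    rw [leftMul_of_mem hg, leftMul_of_mem (hle hg)]
    exact Prod.ext (by simp [retract_mul K hg, mul_assoc]) rfl⟩

/-- The equivariant map preserving the second component. -/
noncomputable def keep (hle : K ≤ K') : EquivariantMap K K' :=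
  ofInvariant hle (fun s => (1, s.2)) fun g hg s => by rw [leftMul_of_mem (hle hg)]

/-- The equivariant map with constant second component. -/
noncomputable def const (hle : K ≤ K') (b : Bool) : EquivariantMap K K' :=
  ofInvariant hle (fun _ => (1, b)) fun _ _ _ => rfl

theorem exists_apply_eq (hle : K ≤ K') (s : K' × Bool) (a : K × Bool) :
    ∃ ρ : EquivariantMap K K', ρ.toFun s = a :=
  ⟨ofInvariant hle (fun _ => ((retract K s.1)⁻¹ * a.1, a.2)) fun _ _ _ => rfl,
    Prod.ext (mul_inv_cancel_left _ _) rfl⟩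

/-- The map `keep` recovers the Boolean and the `retract`; the indicator of the coset `K s` shows
that `t` is in the same right coset. On a coset `retract` is injective. -/
theorem eq_of_forall (hle : K ≤ K') {s t : K' × Bool}
    (h : ∀ ρ : EquivariantMap K K', ρ.toFun s = ρ.toFun t) : s = t := by
  classical
  have h1 : retract K s.1 = retract K t.1 := by
    simpa [keep, ofInvariant] using congrArg Prod.fst (h (keep hle))
  have h2 : s.2 = t.2 := congrArg (fun v : K × Bool => v.2) (h (keep hle))
  have h3 := congrArg Prod.snd (h (ofInvariant hle
    (fun x => (1, decide ((x.1 : G) * (s.1 : G)⁻¹ ∈ K))) fun g hg x => by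
      rw [leftMul_of_mem (hle hg)]
      refine Prod.ext rfl (decide_eq_decide.2 ?_)
      simp only [Subgroup.coe_mul, mul_assoc]
      exact K.mul_mem_cancel_left hg))
  have h4 : (t.1 : G) * (s.1 : G)⁻¹ ∈ K := by
    simpa [ofInvariant, K.one_mem] using h3
  have h5 := retract_mul K h4 s.1
  rw [inv_mul_cancel_right, ← h1] at h5
  have h6 : (t.1 : G) * (s.1 : G)⁻¹ = 1 := congrArg Subtype.val (right_eq_mul.1 h5)
  exact Prod.ext (Subtype.ext (mul_inv_eq_one.1 h6).symm) h2

/-- A map on `K' × Bool` compatible with all equivariant maps is a left multiplication. -/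
theorem exists_leftMul (hle : K ≤ K') (π : K × Bool → K × Bool) (π' : K' × Bool → K' × Bool)
    (h : ∀ (ρ : EquivariantMap K K') s, ρ.toFun (π' s) = π (ρ.toFun s)) :
    ∃ g ∈ K', ∀ s, π' s = leftMul K' g s := by
  refine ⟨(π' (1, false)).1, (π' (1, false)).1.2, fun s => ?_⟩
  rw [leftMul_of_mem (π' (1, false)).1.2]
  refine eq_of_forall hle fun ρ => ?_
  -- Right multiplication commutes with left multiplication, so precomposing `ρ` with it gives
  -- another equivariant map. This one carries `(1, false)` to `ρ s`, so the value of `π'` at `(1,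
  -- false)` determines `π' s`.
  have h1 := h ⟨fun x => ρ.toFun (x.1 * s.1, s.2), fun g hg x => by
    simp only [← ρ.map_leftMul g hg, leftMul_of_mem (hle hg), mul_assoc]⟩ (1, false)
  simp only [one_mul] at h1
  rw [h ρ s]
  exact h1.symm

instance [Finite K] [Finite K'] : Finite (EquivariantMap K K') :=
  Finite.of_injective toFun fun _ _ => EquivariantMap.ext

theorem card_le (hle : K ≤ K') [Finite K'] :
    Nat.card (EquivariantMap K K') ≤ Nat.card (K' × Bool) ^ Nat.card (K' × Bool) := by
  have : Finite K := Finite.of_injective _ (Subgroup.inclusion_injective hle)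
  have h1 : Nat.card (K × Bool) ≤ Nat.card (K' × Bool) :=
    Nat.card_le_card_of_injective (Prod.map (Subgroup.inclusion hle) id)
      ((Subgroup.inclusion_injective hle).prodMap Function.injective_id)
  calc Nat.card (EquivariantMap K K') ≤ Nat.card (K' × Bool → K × Bool) :=
        Nat.card_le_card_of_injective toFun fun _ _ => EquivariantMap.ext
    _ = Nat.card (K × Bool) ^ Nat.card (K' × Bool) := Nat.card_fun
    _ ≤ _ := Nat.pow_le_pow_left h1 _

open Classical in
/-- An enumeration of all pairs of equivariant maps. -/
noncomputable def pair (hle : K ≤ K') [Finite K] [Finite K'] (j : ℕ) :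
    EquivariantMap K K' × EquivariantMap K K' :=
  if h : j < Nat.card (EquivariantMap K K' × EquivariantMap K K') then
    (Finite.equivFin _).symm ⟨j, h⟩ else (keep hle, keep hle)

theorem exists_pair_eq (hle : K ≤ K') [Finite K] [Finite K']
    (v : EquivariantMap K K' × EquivariantMap K K') :
    ∃ j < Nat.card (EquivariantMap K K' × EquivariantMap K K'), pair hle j = v := by
  refine ⟨Finite.equivFin _ v, (Finite.equivFin _ v).2, ?_⟩
  rw [pair, dif_pos (Finite.equivFin _ v).2]
  exact (Finite.equivFin _).symm_apply_apply v

/-- The word in equivariant maps defining the substitution. -/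
noncomputable def word (hle : K ≤ K') [Finite K] [Finite K'] (i : ℤ) : EquivariantMap K K' :=
  -- With `N` pairs the layout is: `keep`, `false`, three `true`, `false`, then each pair followed
  -- by `false`, and `keep` at the last position `3 * N + 6`.
  if i = 0 ∨ i = 3 * Nat.card (EquivariantMap K K' × EquivariantMap K K') + 6 then keep hle
  else if i = 1 then const hle false
  else if i ≤ 4 then const hle true
  else if i % 3 = 2 then const hle false
  else if i % 3 = 0 then (pair hle ((i - 6) / 3).toNat).1
  else (pair hle ((i - 7) / 3).toNat).2

section word

variable (hle : K ≤ K') [Finite K] [Finite K']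

theorem word_fst {j : ℕ} (hj : j < Nat.card (EquivariantMap K K' × EquivariantMap K K')) :
    word hle (6 + 3 * j) = (pair hle j).1 := by
  rw [word, if_neg (by omega), if_neg (by omega), if_neg (by omega), if_neg (by omega),
    if_pos (by omega)]
  congr 2
  omega

theorem word_snd (j : ℕ) :
    word hle (6 + 3 * j + 1) = (pair hle j).2 := by
  rw [word, if_neg (by omega), if_neg (by omega), if_neg (by omega), if_neg (by omega),
    if_neg (by omega)]
  congr 2
  omega

theorem word_marker {i : ℤ} (h2 : 2 ≤ i) (h4 : i ≤ 4) (s : K' × Bool) :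
    ((word hle i).toFun s).2 = true := by
  rw [word, if_neg (by omega), if_neg (by omega), if_pos (by omega)]
  rfl

theorem word_one (s : K' × Bool) : ((word hle 1).toFun s).2 = false := by
  rw [word, if_neg (by omega), if_pos rfl]
  rfl

theorem word_separator {i : ℤ} (h : 5 ≤ i) (h3 : i % 3 = 2) (s : K' × Bool) :
    ((word hle i).toFun s).2 = false := by
  rw [word, if_neg (by omega), if_neg (by omega), if_neg (by omega), if_pos h3]
  rfl

theorem exists_word_eq (ρ ρ' : EquivariantMap K K') :
    ∃ i : ℤ, 1 ≤ i ∧ i ≤ 3 * Nat.card (EquivariantMap K K' × EquivariantMap K K') + 5 ∧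
      word hle i = ρ ∧ word hle (i + 1) = ρ' := by
  obtain ⟨j, hj, hv⟩ := exists_pair_eq hle (ρ, ρ')
  refine ⟨6 + 3 * j, by omega, by omega, ?_, ?_⟩
  · rw [word_fst hle hj, hv]
  · rw [word_snd hle j, hv]

end word

end EquivariantMap

end EquivariantMaps

/-! ### The block system of a chain of finite subgroups and its automorphisms -/

section GroupSystem

open EquivariantMap

variable {G : Type u} [Group G] (H : ℕ → Subgroup G) (hmono : Monotone H)
  (hfin : ∀ k, Finite (H k))

/-- The directive sequence attached to an increasing sequence of finite subgroups. -/
noncomputable def groupSystem : BlockSystem.{u} (Nat.card (H 0 × Bool)) where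
  L k := H k × Bool
  finite k := inferInstance
  M k := 3 * Nat.card (EquivariantMap (H k) (H (k + 1)) × EquivariantMap (H k) (H (k + 1))) + 7
  three_le_M k := by omega
  τ k s i := (word (hmono (k.le_add_right 1)) i).toFun s
  ty _ s := s.2
  ty_surj k b := ⟨(1, b), rfl⟩
  e := Finite.equivFin _
  mark k z n := by
    generalize hN : Nat.card (EquivariantMap (H k) (H (k + 1)) ×
      EquivariantMap (H k) (H (k + 1))) = N
    have hdiv : ∀ q p : ℤ, 0 ≤ p → p < (3 * N + 7 : ℕ) →
        (q * (3 * N + 7 : ℕ) + p) / (3 * N + 7 : ℕ) = q ∧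
        (q * (3 * N + 7 : ℕ) + p) % (3 * N + 7 : ℕ) = p := by
      intro q p h0 h1
      constructor
      · rw [add_comm, Int.add_mul_ediv_right _ _ (by omega), Int.ediv_eq_zero_of_lt h0 h1, zero_add]
      · rw [add_comm, Int.add_mul_emod_self_right, Int.emod_eq_of_lt h0 h1]
    have h0 := Int.emod_nonneg n (b := (3 * N + 7 : ℕ)) (by omega)
    have h1 := Int.emod_lt_of_pos n (b := (3 * N + 7 : ℕ)) (by omega)
    have hn : n = n / (3 * N + 7 : ℕ) * (3 * N + 7 : ℕ) + n % (3 * N + 7 : ℕ) := by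
      rw [mul_comm]; exact (Int.mul_ediv_add_emod n _).symm
    generalize n / ((3 * N + 7 : ℕ) : ℤ) = q at hn ⊢
    generalize n % ((3 * N + 7 : ℕ) : ℤ) = p at hn h0 h1 ⊢
    subst hn
    constructor
    · intro h
      have key : ∀ q' p' : ℤ, 0 ≤ p' → p' < (3 * N + 7 : ℕ) →
          q * (3 * N + 7 : ℕ) + p ≤ q' * (3 * N + 7 : ℕ) + p' →
          q' * (3 * N + 7 : ℕ) + p' ≤ q * (3 * N + 7 : ℕ) + p + 2 →
          ((word (hmono (k.le_add_right 1)) p').toFun (z q')).2 ≠ false := by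
        intro q' p' h2 h3 h4 h5
        have h6 := h _ h4 h5
        rw [(hdiv q' p' h2 h3).1, (hdiv q' p' h2 h3).2] at h6
        rw [h6]
        decide
      -- A window of length 3 starting elsewhere meets position 1 of this block, a separator, or,
      -- when it starts at the last position, position 1 of the next block.
      by_contra hp
      by_cases hp1 : p ≤ 1
      · exact key q 1 (by omega) (by omega) (by omega) (by omega) (word_one _ _)
      by_cases hp2 : p ≤ 3 * N + 5
      · exact key q (5 + 3 * ((p - 3) / 3)) (by omega) (by omega) (by omega) (by omega)
          (word_separator _ (by omega) (by omega) _)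
      · have h8 : (q + 1) * ((3 * N + 7 : ℕ) : ℤ) = q * (3 * N + 7 : ℕ) + (3 * N + 7 : ℕ) := by ring
        exact key (q + 1) 1 (by omega) (by omega) (by rw [h8]; omega) (by rw [h8]; omega)
          (word_one _ _)
    · rintro rfl i h2 h3
      have h4 := hdiv q (i - q * (3 * N + 7 : ℕ)) (by omega) (by omega)
      rw [add_sub_cancel] at h4
      rw [h4.1, h4.2]
      exact word_marker _ (by omega) (by omega) _
  ty_first k s := by
    rw [word, if_pos (Or.inl rfl)]
    rfl
  ty_last k s := by
    rw [word, if_pos (Or.inr (by push_cast; ring))]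
    rfl
  pairs k s a b := by
    obtain ⟨ρ, rfl⟩ := exists_apply_eq (hmono (k.le_add_right 1)) s a
    obtain ⟨ρ', rfl⟩ := exists_apply_eq (hmono (k.le_add_right 1)) s b
    obtain ⟨i, h1, h2, h3, h4⟩ := exists_word_eq (hmono (k.le_add_right 1)) ρ ρ'
    exact ⟨i, by omega, by omega, by rw [h3], by rw [h4]⟩
  interior k s t h := by
    refine eq_of_forall (hmono (k.le_add_right 1)) fun ρ => ?_
    obtain ⟨i, h1, h2, h3, -⟩ := exists_word_eq (hmono (k.le_add_right 1)) ρ ρ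
    have := h i h1 (by push_cast; omega)
    rwa [h3] at this

namespace groupSystem

open TwoSidedSubshift BlockSystem

/-- The first level at which `g` occurs. -/
noncomputable def level (g : G) : ℕ := sInf {k | g ∈ H k}

variable {H}

theorem mem_of_level_le (hmono : Monotone H) (hH : ∀ g, ∃ k, g ∈ H k) {g : G} {k : ℕ}
    (hk : level H g ≤ k) : g ∈ H k :=
  hmono hk (Nat.sInf_mem (hH g))

theorem level_le {g : G} {k : ℕ} (hk : g ∈ H k) : level H g ≤ k := Nat.sInf_le hk

theorem exists_act (hH : ∀ g, ∃ k, g ∈ H k) (g : G) (x : (groupSystem H hmono hfin).X.carrier) :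
    ∃ x' : (groupSystem H hmono hfin).X.carrier, ∀ k ≥ level H g, ∀ o a,
      (groupSystem H hmono hfin).Dec k x.1 o a →
      (groupSystem H hmono hfin).Dec k x'.1 o fun i => leftMul (H k) g (a i) := by
  obtain ⟨x', hx', h⟩ := exists_relabeled (S := groupSystem H hmono hfin)
    (π := fun k => leftMul (H k) g)
    (fun k hk s i => (word (hmono (k.le_add_right 1)) i).map_leftMul g
      (mem_of_level_le hmono hH hk) s) x.2
  exact ⟨⟨x', hx'⟩, h⟩

/-- The action of the group on the subshift. -/
noncomputable def act (hH : ∀ g, ∃ k, g ∈ H k) (g : G)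
    (x : (groupSystem H hmono hfin).X.carrier) : (groupSystem H hmono hfin).X.carrier :=
  (exists_act hmono hfin hH g x).choose

variable (hH : ∀ g, ∃ k, g ∈ H k)

theorem dec_act (g : G) (x : (groupSystem H hmono hfin).X.carrier) {k : ℕ} (hk : level H g ≤ k)
    {o : ℤ} {a : ℤ → H k × Bool} (h : (groupSystem H hmono hfin).Dec k x.1 o a) :
    (groupSystem H hmono hfin).Dec k (act hmono hfin hH g x).1 o
      fun i => leftMul (H k) g (a i) :=
  (exists_act hmono hfin hH g x).choose_spec k hk o a h

theorem act_one (x : (groupSystem H hmono hfin).X.carrier) : act hmono hfin hH 1 x = x := by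
  obtain ⟨o, a, h⟩ := x.2 (level H 1)
  have h1 := dec_act hmono hfin hH 1 x le_rfl h
  have h2 : (fun i => leftMul (H (level H 1)) 1 (a i)) = a := funext fun i => leftMul_one _ _
  rw [h2] at h1
  exact Subtype.ext (h1.eq h)

theorem act_mul (g h : G) (x : (groupSystem H hmono hfin).X.carrier) :
    act hmono hfin hH (g * h) x = act hmono hfin hH g (act hmono hfin hH h x) := by
  obtain ⟨k, hk1, hk2, hk3⟩ : ∃ k, level H g ≤ k ∧ level H h ≤ k ∧ level H (g * h) ≤ k :=
    ⟨max (level H g) (max (level H h) (level H (g * h))), by simp⟩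
  obtain ⟨o, a, hx⟩ := x.2 k
  have h1 := dec_act hmono hfin hH g _ hk1 (dec_act hmono hfin hH h x hk2 hx)
  have h2 := dec_act hmono hfin hH (g * h) x hk3 hx
  have h3 : (fun i => leftMul (H k) (g * h) (a i)) =
      fun i => leftMul (H k) g (leftMul (H k) h (a i)) :=
    funext fun i => leftMul_mul (mem_of_level_le hmono hH hk1) (mem_of_level_le hmono hH hk2) _
  rw [h3] at h2
  exact Subtype.ext (h2.eq h1)

theorem continuous_act (g : G) : Continuous (act hmono hfin hH g) :=
  continuous_of_relabeling (S := groupSystem H hmono hfin) (leftMul (H (level H g)) g) _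
    fun x _ _ h => dec_act hmono hfin hH g x le_rfl h

/-- The group acts by automorphisms of the subshift. -/
noncomputable def actAut : G →* Aut (groupSystem H hmono hfin).X :=
  MonoidHom.mk' (fun g =>
    ⟨{ toFun := act hmono hfin hH g
       invFun := act hmono hfin hH g⁻¹
       left_inv := fun x => by rw [← act_mul, inv_mul_cancel, act_one]
       right_inv := fun x => by rw [← act_mul, mul_inv_cancel, act_one]
       continuous_toFun := continuous_act hmono hfin hH g
       continuous_invFun := continuous_act hmono hfin hH g⁻¹ },
      sigma_of_relabeling (S := groupSystem H hmono hfin) (leftMul (H (level H g)) g) _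
        fun x _ _ h => dec_act hmono hfin hH g x le_rfl h⟩)
    fun g h => Subtype.ext (Homeomorph.ext fun x => act_mul hmono hfin hH g h x)

theorem actAut_apply (g : G) (x : (groupSystem H hmono hfin).X.carrier) :
    (actAut hmono hfin hH g).1 x = act hmono hfin hH g x := rfl

theorem eq_one_of_actAut_eq_zpow {g : G} {t : ℤ}
    (h : actAut hmono hfin hH g = sigmaAut (groupSystem H hmono hfin).X ^ t) : g = 1 := by
  obtain ⟨x, hx⟩ := (groupSystem H hmono hfin).X_nonempty
  -- At such a level `|t| < len k`. The action keeps block boundaries and the shift moves them by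
  -- `t`, so `len k` divides `t` and `t = 0`.
  obtain ⟨k, hk1, hk2⟩ : ∃ k, level H g ≤ k ∧ t.natAbs ≤ k :=
    ⟨max (level H g) t.natAbs, by simp⟩
  obtain ⟨o, a, ha⟩ := hx k
  have h1 := dec_act hmono hfin hH g ⟨x, hx⟩ hk1 ha
  have h2 : (act hmono hfin hH g ⟨x, hx⟩).1 = shift t x := by
    rw [← actAut_apply, h, sigmaAut_zpow_apply]
  rw [h2] at h1
  obtain ⟨c, hc, -⟩ := (ha.shift t).unique h1
  have h3 := (groupSystem H hmono hfin).two_pow_le_len k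
  have h4 : k < 2 ^ k := Nat.lt_two_pow_self
  have h5 : t = 0 := Int.eq_zero_of_abs_lt_dvd (m := ((groupSystem H hmono hfin).len k : ℤ))
    ⟨c, by linarith⟩ (by rw [Int.abs_eq_natAbs]; omega)
  subst h5
  have h6 := ha.shift 0
  rw [sub_zero] at h6
  exact eq_one_of_leftMul_eq (mem_of_level_le hmono hH hk1) (congrFun (h6.unique_seq h1) 0)

theorem exists_zpow_mul_eq_actAut (φ : Aut (groupSystem H hmono hfin).X) :
    ∃ (D : ℤ) (g : G), sigmaAut (groupSystem H hmono hfin).X ^ D * φ = actAut hmono hfin hH g := by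
  obtain ⟨x, hx⟩ := (groupSystem H hmono hfin).X_nonempty
  obtain ⟨D, k, π, hπ⟩ := exists_relabeling φ ⟨x, hx⟩
  have hcomp := relabeling_compatible hx (hπ k le_rfl) (hπ (k + 1) (Nat.le_succ k))
  -- Every equivariant map occurs in the substitution word, so two consecutive levels already
  -- determine `g`.
  obtain ⟨g, hg, hgπ⟩ := exists_leftMul (hmono (k.le_add_right 1)) (π k) (π (k + 1)) fun ρ s => by
    obtain ⟨i, h1, h2, rfl, -⟩ := exists_word_eq (hmono (k.le_add_right 1)) ρ ρ
    exact hcomp s i (by omega) (by simp only [groupSystem]; push_cast; omega)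
  obtain ⟨o, a, ha⟩ := hx (k + 1)
  refine ⟨D, g, aut_ext ⟨x, hx⟩ (Subtype.ext ?_)⟩
  have h1 := hπ (k + 1) (Nat.le_succ k) o a ha
  have h2 := dec_act hmono hfin hH g ⟨x, hx⟩ (level_le hg) ha
  have h3 : (fun i => π (k + 1) (a i)) = fun i => leftMul (H (k + 1)) g (a i) :=
    funext fun i => hgπ _
  rw [h3] at h1
  exact h1.eq h2

theorem nonempty_quotient_mulEquiv (hH : ∀ g, ∃ k, g ∈ H k) :
    Nonempty ((Aut (groupSystem H hmono hfin).X ⧸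
      Subgroup.zpowers (sigmaAut (groupSystem H hmono hfin).X)) ≃* G) := by
  let N := Subgroup.zpowers (sigmaAut (groupSystem H hmono hfin).X)
  refine ⟨(MulEquiv.ofBijective ((QuotientGroup.mk' N).comp (actAut hmono hfin hH))
    ⟨?_, ?_⟩).symm⟩
  · rw [injective_iff_map_eq_one]
    intro g hg
    obtain ⟨t, ht⟩ := Subgroup.mem_zpowers_iff.1 ((QuotientGroup.eq_one_iff _).1 hg)
    exact eq_one_of_actAut_eq_zpow hmono hfin hH ht.symm
  · intro v
    obtain ⟨φ, rfl⟩ := QuotientGroup.mk'_surjective N v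
    obtain ⟨D, g, h⟩ := exists_zpow_mul_eq_actAut hmono hfin hH φ
    refine ⟨g, ?_⟩
    rw [MonoidHom.comp_apply, ← h, map_mul]
    have h1 : QuotientGroup.mk' N (sigmaAut (groupSystem H hmono hfin).X ^ D) = 1 :=
      (QuotientGroup.eq_one_iff _).2 (Subgroup.zpow_mem_zpowers _ _)
    rw [h1, one_mul]

/-- A bound for the complexity in terms of the number of letters of level `k + 1`. -/
theorem complexity_le {c k n : ℕ} (hc : Nat.card (H (k + 1) × Bool) ≤ c)
    (hn : n ≤ (groupSystem H hmono hfin).len (k + 1)) :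
    complexity (groupSystem H hmono hfin).X n ≤
      c ^ 2 * (3 * (c ^ c * c ^ c) + 7) * (groupSystem H hmono hfin).len k := by
  have h1 := (groupSystem H hmono hfin).complexity_le hn
  have hc0 : 0 < c := lt_of_lt_of_le Nat.card_pos hc
  have h2 : Nat.card (EquivariantMap (H k) (H (k + 1))) ≤ c ^ c :=
    (card_le (hmono (k.le_add_right 1))).trans
      ((Nat.pow_le_pow_left hc _).trans (Nat.pow_le_pow_right hc0 hc))
  refine h1.trans ?_
  have h3 : (groupSystem H hmono hfin).len (k + 1) = (groupSystem H hmono hfin).len k *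
      (3 * Nat.card (EquivariantMap (H k) (H (k + 1)) × EquivariantMap (H k) (H (k + 1))) + 7) :=
    rfl
  have h4 : Nat.card (EquivariantMap (H k) (H (k + 1)) × EquivariantMap (H k) (H (k + 1))) ≤
      c ^ c * c ^ c := by
    rw [Nat.card_prod]
    exact Nat.mul_le_mul h2 h2
  calc _ ≤ c ^ 2 * ((groupSystem H hmono hfin).len k * (3 * (c ^ c * c ^ c) + 7)) := by
        rw [h3]
        gcongr
        exact hc
    _ = _ := by ring

end groupSystem

end GroupSystem

/-! ### Slow exhaustion and the complexity estimate -/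

/-- For `g` tending to infinity, there is a slowly growing monotone sequence `s` with
`D (s k) ≤ g k` eventually. -/
theorem exists_slow_monotone (D : ℕ → ℝ) (g : ℕ → ℝ) (hg : Monotone g)
    (hg_top : Tendsto g atTop atTop) :
    ∃ s : ℕ → ℕ, Monotone s ∧ Tendsto s atTop atTop ∧ ∀ᶠ k in atTop, D (s k) ≤ g k := by
  classical
  -- If no `s ≤ k` qualifies the value is `0`, so the bound holds only once `D 0 ≤ g k`.
  refine ⟨fun k => Nat.findGreatest (fun s => D s ≤ g k) k, ?_, ?_, ?_⟩
  · intro k l hkl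
    exact Nat.findGreatest_mono (fun s hs => hs.trans (hg hkl)) hkl
  · rw [tendsto_atTop]
    intro b
    filter_upwards [hg_top.eventually_ge_atTop (D b), eventually_ge_atTop b] with k h1 h2
    exact Nat.le_findGreatest h2 h1
  · filter_upwards [hg_top.eventually_ge_atTop (D 0)] with k h1
    exact Nat.findGreatest_spec (P := fun s => D s ≤ g k) (Nat.zero_le k) h1

/-- A countable locally finite group is the union of an increasing sequence of finite subgroups. -/
theorem IsLocallyFiniteGroup.exists_exhaustion {G : Type*} [Group G] [Countable G]
    (hG : IsLocallyFiniteGroup G) :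
    ∃ F : ℕ → Subgroup G, Monotone F ∧ (∀ k, Finite (F k)) ∧ ∀ g, ∃ k, g ∈ F k := by
  obtain ⟨e, he⟩ := exists_surjective_nat G
  refine ⟨fun k => Subgroup.closure (e '' Set.Iio k), ?_, ?_, ?_⟩
  · intro k l hkl
    exact Subgroup.closure_mono (Set.image_mono (Set.Iio_subset_Iio hkl))
  · intro k
    refine hG _ ((Subgroup.fg_iff _).2 ⟨_, rfl, (Set.finite_Iio k).image e⟩)
  · intro g
    obtain ⟨k, rfl⟩ := he g
    exact ⟨k + 1, Subgroup.subset_closure ⟨k, Nat.lt_succ_self k, rfl⟩⟩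

theorem theorem5 (G : Type*) [Group G] [Countable G] (hG : IsLocallyFiniteGroup G)
    (f : ℕ → ℝ) (hf : Monotone f) (hf_unbounded : ¬ BddAbove (Set.range f)) :
    ∃ (m : ℕ) (X : SymbolicDynamics.FullShift.Subshift (Fin m) ℤ),
      TwoSidedSubshift.IsMinimal X ∧
      Nonempty ((TwoSidedSubshift.Aut X ⧸
        Subgroup.zpowers (TwoSidedSubshift.sigmaAut X)) ≃* G) ∧
      Tendsto (fun n : ℕ => (TwoSidedSubshift.complexity X n : ℝ) / ((n : ℝ) * f n))
        atTop (𝓝 0) := by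
  obtain ⟨F, hFmono, hFfin, hF⟩ := hG.exists_exhaustion
  have hf_top : Tendsto f atTop atTop := tendsto_atTop_atTop_of_monotone' hf hf_unbounded
  let D : ℕ → ℕ := fun s => Nat.card (F s × Bool) ^ 2 *
    (3 * (Nat.card (F s × Bool) ^ Nat.card (F s × Bool) *
      Nat.card (F s × Bool) ^ Nat.card (F s × Bool)) + 7)
  have hpow : Tendsto (fun k : ℕ => 2 ^ (k - 1)) atTop atTop :=
    (tendsto_pow_atTop_atTop_of_one_lt (r := 2) one_lt_two).comp (tendsto_sub_atTop_nat 1)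
  obtain ⟨s, hs, hs_top, hsD⟩ := exists_slow_monotone (fun i => D i)
    -- The bound is used at level `k + 1` for `n ≥ len k ≥ 2 ^ k`, hence the exponent `k - 1`. The
    -- square root leaves a factor `1 / √(f n)` in the quotient.
    (fun k => √(f (2 ^ (k - 1))))
    (fun k l hkl => Real.sqrt_le_sqrt (hf (Nat.pow_le_pow_right two_pos (by omega))))
    (Real.tendsto_sqrt_atTop.comp (hf_top.comp hpow))
  have hmono : Monotone fun k => F (s k) := hFmono.comp hs
  have hfin : ∀ k, Finite (F (s k)) := fun k => hFfin _
  have hH : ∀ g, ∃ k, g ∈ F (s k) := fun g => by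
    obtain ⟨i, hi⟩ := hF g
    obtain ⟨k, hk⟩ := (hs_top.eventually_ge_atTop i).exists
    exact ⟨k, hFmono hk hi⟩
  let S := groupSystem (fun k => F (s k)) hmono hfin
  refine ⟨_, S.X, S.isMinimal, groupSystem.nonempty_quotient_mulEquiv hmono hfin hH, ?_⟩
  have hlim : Tendsto (fun n : ℕ => (√(f n))⁻¹) atTop (𝓝 0) :=
    tendsto_inv_atTop_zero.comp (Real.tendsto_sqrt_atTop.comp hf_top)
  obtain ⟨k₀, hk₀⟩ := eventually_atTop.1 hsD
  have hbound : ∀ᶠ n : ℕ in atTop,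
      (TwoSidedSubshift.complexity S.X n : ℝ) / ((n : ℝ) * f n) ≤ (√(f n))⁻¹ := by
    filter_upwards [eventually_ge_atTop (S.len k₀), eventually_ge_atTop 1,
      hf_top.eventually_gt_atTop 0] with n hn hn1 hfn
    have hex : ∃ j, n ≤ S.len j := ⟨n, (Nat.lt_two_pow_self).le.trans (S.two_pow_le_len n)⟩
    obtain ⟨k, hk, hnk, hkn⟩ : ∃ k ≥ k₀, n ≤ S.len (k + 1) ∧ S.len k ≤ n := by
      by_contra! hcon
      have hall : ∀ k ≥ k₀, S.len k ≤ n := by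
        intro k hk
        induction k, hk using Nat.le_induction with
        | base => exact hn
        | succ k hk ih =>
          by_contra! h
          exact absurd ih (not_le.2 (hcon k hk h.le))
      have h1 := hall (max k₀ n) (le_max_left _ _)
      have h2 := S.two_pow_le_len (max k₀ n)
      have h3 : max k₀ n < 2 ^ max k₀ n := Nat.lt_two_pow_self
      omega
    have h1 : TwoSidedSubshift.complexity S.X n ≤ D (s (k + 1)) * S.len k :=
      groupSystem.complexity_le hmono hfin le_rfl hnk
    have h2 : (D (s (k + 1)) : ℝ) ≤ √(f n) :=
      (hk₀ (k + 1) (by omega)).trans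
        (Real.sqrt_le_sqrt (hf (by simpa using (S.two_pow_le_len k).trans hkn)))
    have hn0 : (0 : ℝ) < n := by exact_mod_cast hn1
    have h3 : (TwoSidedSubshift.complexity S.X n : ℝ) ≤ √(f n) * n :=
      calc (TwoSidedSubshift.complexity S.X n : ℝ) ≤ D (s (k + 1)) * S.len k := by
            exact_mod_cast h1
        _ ≤ √(f n) * n := by gcongr
    have h4 : 0 < √(f n) := Real.sqrt_pos.2 hfn
    rw [div_le_iff₀ (by positivity)]
    calc (TwoSidedSubshift.complexity S.X n : ℝ) ≤ √(f n) * n := h3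
      _ = (√(f n))⁻¹ * (n * (√(f n) * √(f n))) := by field_simp
      _ = _ := by rw [Real.mul_self_sqrt hfn.le]
  refine tendsto_of_tendsto_of_tendsto_of_le_of_le' tendsto_const_nhds hlim ?_ hbound
  filter_upwards [hf_top.eventually_ge_atTop 0] with n hn
  positivity
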